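/- Let $d \ge 2$ and let $\Delta$ be a finite simplicial complex of dimension $d-1$ on a vertex set $V$ (the empty face is a face of $\Delta$) such that (I) $\Delta$ is pure, i.e. all inclusion-maximal faces have the same dimension; (II) $\Delta$ is balanced, with a given colouring $\kappa : V \to [d] = \{1,\dots,d\}$ such that $\kappa(v) \neq \kappa(w)$ for any two distinct vertices $v, w$ of a common face; (III) for every face $F \in \Delta$ with $0 \le |F| < d-1$, the link $\mathrm{lk}_\Delta F = \{G \in \Delta : F \cap G = \emptyset,\ F \cup G \in \Delta\}$ is connected. Let $S \subseteq [d]$ with $|S| = 2$ and let $\Delta_S = \{F \in \Delta : \kappa(F) \subseteq S\}$. For a complex $\Gamma$ of dimension $e-1$ let $f_i(\Gamma)$ be the number of its $i$-dimensional faces ($f_{-1}(\Gamma) = 1$), and $h_i(\Gamma) = \sum_{j=0}^{i} (-1)^{i-j} \binom{e-j}{e-i} f_{j-1}(\Gamma)$. Then, for every base point $x$ of the geometric realization $|\Delta|$, the fundamental group $\pi_1(|\Delta|, x)$ is finitely generated, and the minimal number $m(\Delta)$ of its generators satisfies $$m(\Delta) \le h_2(\Delta_S), \qquad \text{where} \quad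 h_2(\Delta_S) = f_1(\Delta_S) - f_0(\Delta_S) + 1 .$$ -/

import Mathlib

/-!
Finite simplicial complexes are modelled by Mathlib's `PreAbstractSimplicialComplex V`, whose
members are the *nonempty* faces; the empty face, which belongs to every complex, is added by
`IsFace`.
-/

namespace PreAbstractSimplicialComplex

variable {V : Type*}

/-- `F` is a face of `Δ`, the empty face included. -/
def IsFace (Δ : PreAbstractSimplicialComplex V) (F : Finset V) : Prop :=
  F = ∅ ∨ F ∈ Δ

/-- A facet is an inclusion-maximal face. -/
def IsFacet (Δ : PreAbstractSimplicialComplex V) (F : Finset V) : Prop :=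
  Maximal Δ.IsFace F

/-- `dim Δ + 1`, the largest number of vertices of a face (for a complex on a finite vertex set,
this is the maximum of a finite nonempty set). -/
noncomputable def dimSucc (Δ : PreAbstractSimplicialComplex V) : ℕ :=
  sSup {k : ℕ | ∃ F : Finset V, Δ.IsFace F ∧ F.card = k}

/-- The dimension of `Δ`, namely the maximum of `|F| - 1` over the faces `F`. -/
noncomputable def dim (Δ : PreAbstractSimplicialComplex V) : ℤ :=
  (Δ.dimSucc : ℤ) - 1

/-- `Δ` is pure: all facets have the same dimension. -/
def IsPure (Δ : PreAbstractSimplicialComplex V) : Prop :=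
  ∀ F G : Finset V, Δ.IsFacet F → Δ.IsFacet G → F.card = G.card

/-- `κ` colours the vertices so that distinct vertices of a common face get distinct colours. -/
def IsProperColoring (Δ : PreAbstractSimplicialComplex V) {C : Type*} (κ : V → C) : Prop :=
  ∀ F ∈ Δ, ∀ v ∈ F, ∀ w ∈ F, v ≠ w → κ v ≠ κ w

/-- The link of `F`: the faces `G` disjoint from `F` such that `F ∪ G` is a face. For `F = ∅` it is
`Δ` itself. -/
def link [DecidableEq V] (Δ : PreAbstractSimplicialComplex V) (F : Finset V) :
    PreAbstractSimplicialComplex V where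
  faces := {G | G ∈ Δ ∧ Disjoint F G ∧ F ∪ G ∈ Δ}
  isRelLowerSet_faces := by
    rintro G ⟨hG, hd, hu⟩
    have hne : G.Nonempty := (Δ.isRelLowerSet_faces hG).1
    refine ⟨hne, fun H hHG hH => ⟨(Δ.isRelLowerSet_faces hG).2 hHG hH, ?_, ?_⟩⟩
    · exact Finset.disjoint_of_subset_right hHG hd
    · exact (Δ.isRelLowerSet_faces hu).2 (Finset.union_subset_union_right hHG)
        (hH.mono Finset.subset_union_right)

/-- The rank selected subcomplex `Δ_S`: the faces all of whose vertices have colours in `S`. -/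
def rankSelected (Δ : PreAbstractSimplicialComplex V) {C : Type*} (κ : V → C) (S : Finset C) :
    PreAbstractSimplicialComplex V where
  faces := {F | F ∈ Δ ∧ ∀ v ∈ F, κ v ∈ S}
  isRelLowerSet_faces := by
    rintro F ⟨hF, hS⟩
    exact ⟨(Δ.isRelLowerSet_faces hF).1, fun H hHF hH =>
      ⟨(Δ.isRelLowerSet_faces hF).2 hHF hH, fun v hv => hS v (hHF hv)⟩⟩

/-- The geometric realization `|Δ|`: the union over the faces `F` of the convex hulls of the
standard basis vectors `e_v`, `v ∈ F`, with the subspace topology of `ℝ^V`. -/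
def realization [DecidableEq V] (Δ : PreAbstractSimplicialComplex V) : Set (V → ℝ) :=
  ⋃ F ∈ Δ, convexHull ℝ ((fun v : V => (Pi.single v 1 : V → ℝ)) '' (F : Set V))

/-- `f_i`, the number of `i`-dimensional faces (`f_{-1} = 1` counts the empty face). -/
noncomputable def fNumber (Δ : PreAbstractSimplicialComplex V) (i : ℤ) : ℕ :=
  {F : Finset V | Δ.IsFace F ∧ (F.card : ℤ) - 1 = i}.ncard

/-- `h_i = ∑_{j=0}^{i} (-1)^{i-j} (d-j choose d-i) f_{j-1}` for `0 ≤ i ≤ d`,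
where `d = dim Δ + 1`. -/
noncomputable def hNumber (Δ : PreAbstractSimplicialComplex V) (i : ℕ) : ℤ :=
  ∑ j ∈ Finset.range (i + 1),
    (-1 : ℤ) ^ (i - j) * ((Δ.dimSucc - j).choose (Δ.dimSucc - i) : ℤ) * (Δ.fNumber ((j : ℤ) - 1) : ℤ)

end PreAbstractSimplicialComplex

/-! Every loop in `|Δ|` is homotopic to an edge loop, so each element of the fundamental group is a
product of edge classes along a closed walk in the 1-skeleton (`isWalkProd_closeUp`), based at a
vertex with colour in `S`. The colours outside `S` are then removed one at a time. If a walk passes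
`u`, `v`, `w` and `v` has the colour being removed, then `u` and `w` lie in the link of `v`. This
link is connected, and a walk from `u` to `w` in it has the same product, because each of its edges
spans a triangle with `v`. The detour avoids the colour of `v`, and so do `u` and `w`, since the
colouring is proper (`LinksConnected.isWalkProd_erase`).

To repeat this, connectivity of links must survive the removal of a colour; the same detour, made
inside the link of a face, proves it (`LinksConnected.erase`). In the end the group is generated by
closed walks in the connected graph `Δ_S`. Collapsing a spanning tree leaves one generator for each
remaining edge, `f₁ - f₀ + 1` in all, which is `h₂` because `Δ_S` has dimension 1. -/

/-! ### Labelled walks and detours -/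

/-- `IsWalkProd R g u w k` says that `k` is the product (in composition order) of the labels `g`
along a walk from `u` to `w` with steps in `R`. -/
inductive IsWalkProd {α K : Type*} [Monoid K] (R : α → α → Prop) (g : α → α → K) :
    α → α → K → Prop
  | nil (u : α) : IsWalkProd R g u u 1
  | snoc {u v w : α} {k : K} : IsWalkProd R g u v k → R v w → IsWalkProd R g u w (g v w * k)

namespace IsWalkProd

variable {α K : Type*} [Monoid K] {R R' : α → α → Prop} {g : α → α → K}

theorem trans {u v w : α} {k l : K} (h : IsWalkProd R g u v k) (h' : IsWalkProd R g v w l) :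
    IsWalkProd R g u w (l * k) := by
  induction h' with
  | nil => simpa using h
  | snoc _ hr ih => rw [mul_assoc]; exact ih.snoc hr

theorem mono {u w : α} {k : K} (h : IsWalkProd R g u w k) (hR : ∀ v v', R v v' → R' v v') :
    IsWalkProd R' g u w k := by
  induction h with
  | nil => exact nil _
  | snoc _ hr ih => exact ih.snoc (hR _ _ hr)

theorem reflTransGen {u v : α} {k : K} (h : IsWalkProd R g u v k) :
    Relation.ReflTransGen R u v := by
  induction h with
  | nil => exact .refl
  | snoc _ hr ih => exact ih.tail hr

theorem of_reflTransGen {u v : α} (h : Relation.ReflTransGen R u v) :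
    IsWalkProd R (fun _ _ => (1 : PUnit.{1})) u v 1 := by
  induction h with
  | refl => exact nil _
  | tail _ hr ih => exact ih.snoc hr

/-- If no two vertices outside `P` are adjacent and every two-step walk through a vertex outside
`P` can be replaced by a walk in `R'`, then walks between vertices of `P` can be replaced by walks
in `R'`. -/
theorem detour {P : α → Prop} (hR : ∀ u v, R u v → P u → P v → R' u v)
    (hP : ∀ u v, R u v → P u ∨ P v)
    (hd : ∀ u v w, R u v → R v w → P u → P w → ¬ P v → IsWalkProd R' g u w (g v w * g u v))
    {u w : α} {k : K} (h : IsWalkProd R g u w k) (hu : P u) (hw : P w) :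
    IsWalkProd R' g u w k := by
  -- At an endpoint outside `P` the last step is kept pending until the walk returns to `P`, when
  -- the two steps are replaced together.
  suffices H : (P w → IsWalkProd R' g u w k) ∧ (¬ P w → ∃ v l, P v ∧ IsWalkProd R' g u v l ∧
      R v w ∧ k = g v w * l) from H.1 hw
  clear hw
  induction h with
  | nil => exact ⟨fun _ => nil _, fun h => absurd hu h⟩
  | @snoc v w k _ hr ih =>
    by_cases hv : P v
    · exact ⟨fun hw => (ih.1 hv).snoc (hR _ _ hr hv hw),
        fun hw => ⟨v, k, hv, ih.1 hv, hr, rfl⟩⟩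
    · have hw : P w := (hP _ _ hr).resolve_left hv
      refine ⟨fun _ => ?_, fun h => absurd hw h⟩
      obtain ⟨a, l, ha, hl, hav, rfl⟩ := ih.2 hv
      rw [← mul_assoc]
      exact hl.trans (hd _ _ _ hav hr ha hw hv)

end IsWalkProd

theorem Relation.ReflTransGen.detour {α : Type*} {R R' : α → α → Prop} {P : α → Prop}
    (hR : ∀ u v, R u v → P u → P v → R' u v) (hP : ∀ u v, R u v → P u ∨ P v)
    (hd : ∀ u v w, R u v → R v w → P u → P w → ¬ P v → Relation.ReflTransGen R' u w)
    {u w : α} (h : Relation.ReflTransGen R u w) (hu : P u) (hw : P w) :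
    Relation.ReflTransGen R' u w :=
  (IsWalkProd.detour hR hP (fun u v w h1 h2 h3 h4 h5 =>
    IsWalkProd.of_reflTransGen (hd u v w h1 h2 h3 h4 h5)) (.of_reflTransGen h) hu hw).reflTransGen

/-! ### Generators from the complement of a spanning tree -/

/-- A group all of whose elements are products of edge labels along closed walks at `v₀` is
generated by `|E| - |V| + 1` elements, where `V` is the component of `v₀`. -/
theorem SimpleGraph.exists_closure_eq_top_of_isWalkProd {V K : Type*} [Finite V] [Group K]
    (G : SimpleGraph V) (v₀ : V) (g : V → V → K) (hinv : ∀ u w, G.Adj u w → g w u = (g u w)⁻¹)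
    (hgen : ∀ k, IsWalkProd G.Adj g v₀ v₀ k) :
    ∃ s : Finset K, Subgroup.closure (s : Set K) = ⊤ ∧
      s.card + {v | G.Reachable v₀ v}.ncard ≤ G.edgeSet.ncard + 1 := by
  classical
  have := Fintype.ofFinite V
  -- The parent of `v` in a breadth-first tree rooted at `v₀`.
  have hp : ∀ v, ∃ p, G.Reachable v₀ v → v ≠ v₀ → G.Adj p v ∧ G.dist v₀ v = G.dist v₀ p + 1 := by
    intro v
    by_cases h : G.Reachable v₀ v ∧ v ≠ v₀
    · obtain ⟨w, hw⟩ := h.1.symm.exists_walk_length_eq_dist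
      cases w with
      | nil => exact absurd rfl h.2
      | @cons _ p _ hadj w' =>
        refine ⟨p, fun _ _ => ⟨hadj.symm, ?_⟩⟩
        rw [SimpleGraph.Walk.length_cons] at hw
        have h1 := SimpleGraph.dist_le w'
        obtain ⟨w'', hw''⟩ := w'.reachable.exists_walk_length_eq_dist
        have h2 := SimpleGraph.dist_le (SimpleGraph.Walk.cons hadj w'')
        rw [SimpleGraph.Walk.length_cons] at h2
        rw [G.dist_comm (u := v₀) (v := v), G.dist_comm (u := v₀) (v := p)]
        omega
    · exact ⟨v, fun h1 h2 => absurd ⟨h1, h2⟩ h⟩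
  choose p hp using hp
  -- `φ v` is the product of labels along the tree path from `v₀` to `v`, by recursion on the
  -- distance.
  let Φ : ℕ → V → K := fun n => n.rec (fun _ => 1) (fun _ φ v => g (p v) v * φ (p v))
  let φ : V → K := fun v => Φ (G.dist v₀ v) v
  have hφ0 : φ v₀ = 1 := by simp [φ, Φ]
  have hφ : ∀ v, G.Reachable v₀ v → v ≠ v₀ → φ v = g (p v) v * φ (p v) := by
    intro v h1 h2
    simp only [φ, (hp v h1 h2).2, Φ]
  -- The class of the loop that follows the tree to `u`, crosses the edge, and returns along the
  -- tree; it is trivial on tree edges.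
  let h : V → V → K := fun u w => (φ w)⁻¹ * g u w * φ u
  let A : Finset V := Finset.univ.filter fun v => G.Reachable v₀ v ∧ v ≠ v₀
  let T : Finset (Sym2 V) := A.image fun v => s(p v, v)
  have hT : T.card = A.card := by
    refine Finset.card_image_of_injOn ?_
    intro v hv w hw hvw
    simp only [A, Finset.coe_filter, Finset.mem_univ, true_and, Set.mem_ofPred_eq] at hv hw
    simp only [Sym2.eq_iff] at hvw
    rcases hvw with h | h
    · exact h.2
    -- Two vertices cannot be parents of each other, as each would be farther from `v₀`.
    · have h1 := (hp v hv.1 hv.2).2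
      have h2 := (hp w hw.1 hw.2).2
      rw [h.1] at h1
      rw [← h.2] at h2
      omega
  have hTE : T ⊆ G.edgeFinset := by
    intro e he
    simp only [T, A, Finset.mem_image, Finset.mem_filter, Finset.mem_univ, true_and] at he
    obtain ⟨v, hv, rfl⟩ := he
    simpa using (hp v hv.1 hv.2).1
  -- One orientation per non-tree edge suffices, since reversal inverts `h`.
  let s : Finset K := (G.edgeFinset \ T).image fun e => h e.out.1 e.out.2
  have hh : ∀ u w, G.Adj u w → h w u = (h u w)⁻¹ := by
    intro u w huw
    simp only [h, hinv u w huw]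
    group
  have hmem : ∀ u w, G.Adj u w → h u w ∈ Subgroup.closure (s : Set K) := by
    intro u w huw
    by_cases ht : s(u, w) ∈ T
    · simp only [T, A, Finset.mem_image, Finset.mem_filter, Finset.mem_univ, true_and] at ht
      obtain ⟨v, hv, hvw⟩ := ht
      have h1 : h (p v) v = 1 := by
        simp only [h, hφ v hv.1 hv.2]
        group
      rcases Sym2.eq_iff.1 hvw with ⟨rfl, rfl⟩ | ⟨rfl, rfl⟩
      · rw [h1]; exact one_mem _
      · rw [hh _ _ huw.symm, h1]; simp
    · have hs : h (s(u, w)).out.1 (s(u, w)).out.2 ∈ Subgroup.closure (s : Set K) := by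
        refine Subgroup.subset_closure (Finset.mem_coe.2 (Finset.mem_image.2 ⟨s(u, w), ?_, rfl⟩))
        simpa [ht] using huw
      have ho : s((s(u, w)).out.1, (s(u, w)).out.2) = s(u, w) := Quot.out_eq _
      rcases Sym2.eq_iff.1 ho with ⟨h1, h2⟩ | ⟨h1, h2⟩
      · rwa [h1, h2] at hs
      · rw [h1, h2, hh _ _ huw] at hs
        simpa using hs
  have hwalk : ∀ w k, IsWalkProd G.Adj g v₀ w k → (φ w)⁻¹ * k ∈ Subgroup.closure (s : Set K) := by
    intro w k hk
    induction hk with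
    | nil => simp [hφ0]
    | @snoc v w k _ hr ih =>
      have := mul_mem (hmem _ _ hr) ih
      convert this using 1
      simp only [h]
      group
  refine ⟨s, ?_, ?_⟩
  · refine (Subgroup.eq_top_iff' _).2 fun k => ?_
    simpa [hφ0] using hwalk v₀ k (hgen k)
  · have h1 : s.card ≤ G.edgeFinset.card - T.card :=
      Finset.card_image_le.trans (Finset.card_sdiff_of_subset hTE).le
    have h2 := Finset.card_le_card hTE
    have h3 : {v | G.Reachable v₀ v}.ncard = A.card + 1 := by
      rw [← Finset.card_insert_of_notMem (a := v₀) (s := A) (by simp [A]), ← Set.ncard_coe_finset]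
      congr 1
      ext v
      by_cases hv : v = v₀ <;> simp [A, hv]
    have h4 : G.edgeSet.ncard = G.edgeFinset.card := by
      rw [← Set.ncard_coe_finset, SimpleGraph.coe_edgeFinset]
    omega

/-! ### Removing colours while keeping links connected -/

namespace PreAbstractSimplicialComplex

variable {V : Type*}

theorem mem_of_subset {Δ : PreAbstractSimplicialComplex V} {F G : Finset V} (hF : F ∈ Δ)
    (hGF : G ⊆ F) (hG : G.Nonempty) : G ∈ Δ :=
  (Δ.isRelLowerSet_faces hF).2 hGF hG

variable [DecidableEq V]

/-- Adjacency in the link of `F` inside the rank selected subcomplex on the colours `T`. -/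
def LinkAdj (Δ : PreAbstractSimplicialComplex V) {C : Type*} (κ : V → C) (T : Finset C)
    (F : Finset V) (u w : V) : Prop :=
  u ≠ w ∧ (u ∉ F ∧ κ u ∈ T) ∧ (w ∉ F ∧ κ w ∈ T) ∧ insert u (insert w F) ∈ Δ

/-- The links of faces of codimension at least two in the rank selected subcomplex on the
colours `T` have connected graphs. -/
def LinksConnected (Δ : PreAbstractSimplicialComplex V) {C : Type*} (κ : V → C)
    (T : Finset C) : Prop :=
  ∀ F : Finset V, Δ.IsFace F → (∀ v ∈ F, κ v ∈ T) → F.card + 2 ≤ T.card →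
    ∀ u w, u ∉ F → κ u ∈ T → insert u F ∈ Δ → w ∉ F → κ w ∈ T → insert w F ∈ Δ →
      Relation.ReflTransGen (Δ.LinkAdj κ T F) u w

variable {Δ : PreAbstractSimplicialComplex V} {C : Type*} {κ : V → C}
  {T : Finset C}

theorem LinkAdj.ne_color (hκ : Δ.IsProperColoring κ) {F : Finset V} {u w : V}
    (h : Δ.LinkAdj κ T F u w) : κ u ≠ κ w :=
  hκ _ h.2.2.2 u (by simp) w (by simp) h.1

theorem LinkAdj.erase [DecidableEq C] {c : C} {F : Finset V} {u w : V} (h : Δ.LinkAdj κ T F u w) (hu : κ u ≠ c)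
    (hw : κ w ≠ c) : Δ.LinkAdj κ (T.erase c) F u w :=
  ⟨h.1, ⟨h.2.1.1, Finset.mem_erase.2 ⟨hu, h.2.1.2⟩⟩, ⟨h.2.2.1.1, Finset.mem_erase.2 ⟨hw, h.2.2.1.2⟩⟩,
    h.2.2.2⟩

theorem LinkAdj.of_insert [DecidableEq C] (hκ : Δ.IsProperColoring κ) {F : Finset V} {u v w : V}
    (h : Δ.LinkAdj κ T (insert v F) u w) : Δ.LinkAdj κ (T.erase (κ v)) F u w := by
  obtain ⟨h1, ⟨h2, h3⟩, ⟨h4, h5⟩, h6⟩ := h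
  simp only [Finset.mem_insert, not_or] at h2 h4
  refine ⟨h1, ⟨h2.2, Finset.mem_erase.2 ⟨?_, h3⟩⟩, ⟨h4.2, Finset.mem_erase.2 ⟨?_, h5⟩⟩, ?_⟩
  · exact hκ _ h6 u (by simp) v (by simp) h2.1
  · exact hκ _ h6 w (by simp) v (by simp) h4.1
  · refine mem_of_subset h6 ?_ (by simp)
    exact Finset.insert_subset_insert _ (Finset.insert_subset_insert _ (Finset.subset_insert _ _))

/-- Both neighbours of `v` are vertices of the link of `insert v F`. The extra vertex is why the
bound is 3 rather than 2. -/
theorem LinksConnected.through (hT : Δ.LinksConnected κ T) {F : Finset V}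
    (hFT : ∀ v ∈ F, κ v ∈ T) (hcard : F.card + 3 ≤ T.card) {u v w : V}
    (huv : Δ.LinkAdj κ T F u v) (hvw : Δ.LinkAdj κ T F v w) :
    Relation.ReflTransGen (Δ.LinkAdj κ T (insert v F)) u w := by
  obtain ⟨h1, ⟨h2, h3⟩, ⟨h4, h5⟩, h6⟩ := huv
  obtain ⟨g1, -, ⟨g4, g5⟩, g6⟩ := hvw
  refine hT (insert v F) (Or.inr (mem_of_subset h6 (by simp) (by simp))) ?_ ?_ u w ?_ h3 h6 ?_ g5 ?_
  · simpa [h5] using hFT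
  · rw [Finset.card_insert_of_notMem h4]; omega
  · simp [h1, h2]
  · simp [g1.symm, g4]
  · rwa [Finset.insert_comm]

/-- A walk in the larger link may visit vertices of colour `c`, but never two in a row. Each is
bypassed inside its own link, where colour `c` does not occur. -/
theorem LinksConnected.erase [DecidableEq C] {c : C} (hκ : Δ.IsProperColoring κ) (hT : Δ.LinksConnected κ T) (hc : c ∈ T) :
    Δ.LinksConnected κ (T.erase c) := by
  intro F hF hFT hcard u w hu huT huF hw hwT hwF
  have hFT' : ∀ v ∈ F, κ v ∈ T := fun v hv => Finset.mem_of_mem_erase (hFT v hv)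
  rw [Finset.card_erase_of_mem hc] at hcard
  have hwalk := hT F hF hFT' (by omega) u w hu (Finset.mem_of_mem_erase huT) huF hw
    (Finset.mem_of_mem_erase hwT) hwF
  refine hwalk.detour (P := fun v => κ v ≠ c) (fun u v h h1 h2 => h.erase h1 h2) ?_ ?_
    (Finset.ne_of_mem_erase huT) (Finset.ne_of_mem_erase hwT)
  · intro u v h
    by_contra! h'
    exact h.ne_color hκ (h'.1.trans h'.2.symm)
  · intro u v w huv hvw _ _ hv
    obtain rfl := not_not.1 hv
    exact Relation.ReflTransGen.mono (fun _ _ h => LinkAdj.of_insert hκ h) _ _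
      (hT.through hFT' (by omega) huv hvw)

/-- The relation `hg` says that labels multiply along triangles. The triangles joining `v` to a walk
in its link therefore carry the product through `v` onto that walk. -/
theorem LinksConnected.isWalkProd_erase [DecidableEq C] {c : C} {K : Type*} [Group K] (hκ : Δ.IsProperColoring κ)
    (hT : Δ.LinksConnected κ T) (hcard : 3 ≤ T.card) {g : V → V → K}
    (hg : ∀ u v w, {u, v, w} ∈ Δ → g v w * g u v = g u w) {u w : V} {k : K}
    (h : IsWalkProd (Δ.LinkAdj κ T ∅) g u w k) (hu : κ u ≠ c) (hw : κ w ≠ c) :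
    IsWalkProd (Δ.LinkAdj κ (T.erase c) ∅) g u w k := by
  refine h.detour (P := fun v => κ v ≠ c) (fun u v h h1 h2 => h.erase h1 h2) ?_ ?_ hu hw
  · intro u v h
    by_contra! h'
    exact h.ne_color hκ (h'.1.trans h'.2.symm)
  · intro u v w huv hvw _ hw' hv
    obtain rfl := not_not.1 hv
    have hwalk := hT.through (by simp) (by simpa using hcard) huv hvw
    have huv' : {u, v} ∈ Δ := huv.2.2.2
    -- These mention `w`, which has to vary in the induction along the link walk.
    clear hvw hw'
    induction hwalk with
    | refl =>
      -- An idempotent in a group is 1, so backtracking `u`, `v`, `u` has trivial product.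
      have h1 : g u u * g u u = g u u :=
        hg u u u (mem_of_subset huv' (by simp) (by simp))
      have h2 : g v u * g u v = 1 := by
        rw [hg u v u (mem_of_subset huv' (by intro x; simp; tauto) (by simp))]
        simpa using h1
      rw [h2]
      exact .nil _
    | @tail a b _ hab ih =>
      have h1 : g a b * g v a = g v b :=
        hg v a b (mem_of_subset hab.2.2.2 (by intro x; simp; tauto) (by simp))
      rw [← h1, mul_assoc]
      exact ih.snoc (hab.of_insert hκ)

theorem isWalkProd_of_subset {K : Type*} [Group K] (hκ : Δ.IsProperColoring κ) [Fintype C] [DecidableEq C]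
    (hT : Δ.LinksConnected κ Finset.univ) {S : Finset C} (hS : S.card = 2) {g : V → V → K}
    (hg : ∀ u v w, {u, v, w} ∈ Δ → g v w * g u v = g u w) (T : Finset C) (hST : S ⊆ T) :
    Δ.LinksConnected κ T ∧ ∀ u w k, κ u ∈ S → κ w ∈ S →
      IsWalkProd (Δ.LinkAdj κ Finset.univ ∅) g u w k → IsWalkProd (Δ.LinkAdj κ T ∅) g u w k := by
  -- Induction on the set `U` of colours already removed.
  suffices H : ∀ U : Finset C, Disjoint S U → Δ.LinksConnected κ Uᶜ ∧ ∀ u w k, κ u ∈ S → κ w ∈ S →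
      IsWalkProd (Δ.LinkAdj κ Finset.univ ∅) g u w k → IsWalkProd (Δ.LinkAdj κ Uᶜ ∅) g u w k by
    have := H Tᶜ (Finset.disjoint_left.2 fun x hx => by simpa using hST hx)
    rwa [compl_compl] at this
  intro U
  induction U using Finset.induction_on with
  | empty => intro _; simpa using hT
  | insert c U hcU ih =>
    intro hd
    rw [Finset.disjoint_insert_right] at hd
    obtain ⟨ih1, ih2⟩ := ih hd.2
    -- Before `c` is removed, the two colours of `S` and `c` itself are all present.
    have hcard : 3 ≤ Uᶜ.card := by
      have : insert c S ⊆ Uᶜ := by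
        intro x hx
        rcases Finset.mem_insert.1 hx with rfl | hx
        · simpa using hcU
        · simpa using Finset.disjoint_left.1 hd.2 hx
      have := Finset.card_le_card this
      rw [Finset.card_insert_of_notMem hd.1] at this
      omega
    rw [Finset.compl_insert]
    refine ⟨ih1.erase hκ (by simpa using hcU), fun u w k hu hw h => ?_⟩
    exact ih1.isWalkProd_erase hκ hcard hg (ih2 u w k hu hw h) (fun h => hd.1 (h ▸ hu))
      (fun h => hd.1 (h ▸ hw))

end PreAbstractSimplicialComplex

/-! ### Straight paths and cones over paths -/

open scoped unitInterval

/-- Paths whose lifts to a simply connected space have the same endpoints are homotopic. -/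
theorem Path.Homotopic.of_lift {X Y : Type*} [TopologicalSpace X] [TopologicalSpace Y]
    [SimplyConnectedSpace Y] (H : C(Y, X)) {a b : X} {y z : Y} (p q : Path a b) (P Q : Path y z)
    (hP : ∀ t, H (P t) = p t) (hQ : ∀ t, H (Q t) = q t) : p.Homotopic q := by
  obtain rfl : H y = a := by simpa using hP 0
  obtain rfl : H z = b := by simpa using hP 1
  have h1 : p = P.map H.continuous := by ext t; exact (hP t).symm
  have h2 : q = Q.map H.continuous := by ext t; exact (hQ t).symm
  rw [h1, h2]
  exact (SimplyConnectedSpace.paths_homotopic P Q).map H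

section Segment

variable {E : Type*} [AddCommGroup E] [Module ℝ E] {A : Set E}

theorem lineMap_mem_of_segment_subset {p q : E} (h : segment ℝ p q ⊆ A) (t : I) :
    AffineMap.lineMap p q (t : ℝ) ∈ A :=
  h (segment_eq_image_lineMap ℝ p q ▸ Set.mem_image_of_mem _ t.2)

variable [TopologicalSpace E] [IsTopologicalAddGroup E] [ContinuousSMul ℝ E]

/-- The straight path in `A` from `p` to `q`. -/
def segmentPath (p q : A) (h : segment ℝ (p : E) q ⊆ A) : Path p q where
  toFun t := ⟨AffineMap.lineMap (p : E) (q : E) (t : ℝ), lineMap_mem_of_segment_subset h t⟩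
  continuous_toFun := by
    refine Continuous.subtype_mk ?_ _
    simp only [AffineMap.lineMap_apply_module']
    fun_prop
  source' := by simp
  target' := by simp

@[simp]
theorem coe_segmentPath_apply (p q : A) (h : segment ℝ (p : E) q ⊆ A) (t : I) :
    (segmentPath p q h t : E) = AffineMap.lineMap (p : E) (q : E) (t : ℝ) :=
  rfl

theorem segmentPath_self (p : A) (h : segment ℝ (p : E) p ⊆ A) :
    segmentPath p p h = Path.refl p := by
  ext t
  simp

/-- The cone over `γ` with apex `v` is a map from the square, and the two routes along its boundary
between opposite corners are homotopic. The side collapsed to `v` gives a constant path, which is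
inserted first. -/
theorem segmentPath_trans_homotopic {v p q : A} (γ : Path p q)
    (h : ∀ t, segment ℝ (v : E) (γ t) ⊆ A) (hp : segment ℝ (v : E) p ⊆ A)
    (hq : segment ℝ (v : E) q ⊆ A) :
    ((segmentPath v p hp).trans γ).Homotopic (segmentPath v q hq) := by
  refine Path.Homotopic.trans ?_
    (Path.Homotopic.Quotient.exact (Path.Homotopic.Quotient.refl_trans (.mk (segmentPath v q hq))))
  let H : C(I × I, A) :=
    ⟨fun x => ⟨AffineMap.lineMap (v : E) (γ x.2 : E) (x.1 : ℝ),
      lineMap_mem_of_segment_subset (h x.2) x.1⟩, by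
        refine Continuous.subtype_mk ?_ _
        simp only [AffineMap.lineMap_apply_module']
        fun_prop⟩
  have : ContractibleSpace I := (convex_Icc (0 : ℝ) 1).contractibleSpace ⟨0, by simp⟩
  let s : Path (0 : I) 1 := ⟨⟨id, continuous_id⟩, rfl, rfl⟩
  refine Path.Homotopic.of_lift H _ _
    ((s.prod (Path.refl (0 : I))).trans ((Path.refl (1 : I)).prod s))
    (((Path.refl (0 : I)).prod s).trans (s.prod (Path.refl (1 : I)))) ?_ ?_
  · intro t
    rw [Path.trans_apply, Path.trans_apply]
    split_ifs <;> ext1 <;> simp [H, s]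
  · intro t
    rw [Path.trans_apply, Path.trans_apply]
    split_ifs <;> ext1 <;> simp [H, s]

end Segment

/-! ### Path classes as elements of the fundamental group -/

section PathClass

open CategoryTheory

variable {X : Type*} [TopologicalSpace X] [PathConnectedSpace X]

/-- A path class, closed up to a loop at `x` along chosen paths from `x`. -/
noncomputable def closeUp (x : X) {p q : X} (γ : Path.Homotopic.Quotient p q) :
    FundamentalGroup X x :=
  ((Path.Homotopic.Quotient.mk (PathConnectedSpace.somePath x p)).trans γ).trans
    (Path.Homotopic.Quotient.mk (PathConnectedSpace.somePath x q)).symm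

/-- The chosen path to the middle point cancels. The later path stands on the left, which is why
`IsWalkProd` multiplies new labels on the left. -/
theorem closeUp_trans (x : X) {p q r : X} (γ : Path.Homotopic.Quotient p q)
    (δ : Path.Homotopic.Quotient q r) :
    closeUp x (γ.trans δ) = closeUp x δ * closeUp x γ := by
  simp only [closeUp, FundamentalGroup.mul_def]
  set a := Path.Homotopic.Quotient.mk (PathConnectedSpace.somePath x p)
  set b := Path.Homotopic.Quotient.mk (PathConnectedSpace.somePath x q)
  set c := Path.Homotopic.Quotient.mk (PathConnectedSpace.somePath x r)
  simp only [Path.Homotopic.Quotient.trans_assoc]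
  rw [← Path.Homotopic.Quotient.trans_assoc b.symm, Path.Homotopic.Quotient.symm_trans,
    Path.Homotopic.Quotient.refl_trans]

theorem closeUp_refl (x p : X) : closeUp x (Path.Homotopic.Quotient.refl p) = 1 := by
  rw [closeUp, Path.Homotopic.Quotient.trans_refl, Path.Homotopic.Quotient.trans_symm]
  rfl

theorem closeUp_cast (x : X) {p q p' q' : X} (γ : Path.Homotopic.Quotient p q) (hp : p' = p)
    (hq : q' = q) : closeUp x (γ.cast hp hq) = closeUp x γ := by
  subst hp hq
  simp

/-- Conjugating `k` by the chosen path from `x` to `p` gives a loop at `p` that closing up turns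
back into `k`. -/
theorem closeUp_surjective (x p : X) (k : FundamentalGroup X x) :
    ∃ γ : Path p p, closeUp x (.mk γ) = k := by
  set a := Path.Homotopic.Quotient.mk (PathConnectedSpace.somePath x p) with ha
  obtain ⟨γ, hγ⟩ := Path.Homotopic.Quotient.mk_surjective
    ((a.symm.trans (FundamentalGroup.toPath k)).trans a)
  refine ⟨γ, ?_⟩
  rw [hγ, closeUp, ← ha]
  simp only [Path.Homotopic.Quotient.trans_assoc, Path.Homotopic.Quotient.trans_symm,
    Path.Homotopic.Quotient.trans_refl]
  rw [← Path.Homotopic.Quotient.trans_assoc, Path.Homotopic.Quotient.trans_symm,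
    Path.Homotopic.Quotient.refl_trans]

end PathClass

section SegmentClass

variable {E : Type*} [AddCommGroup E] [Module ℝ E] [TopologicalSpace E] [IsTopologicalAddGroup E]
  [ContinuousSMul ℝ E] {A : Set E} [PathConnectedSpace A] (x : A)

open Classical in
/-- The loop class at `x` of the segment from `p` to `q`, if this segment lies in `A`. -/
noncomputable def segmentClass (p q : E) : FundamentalGroup A x :=
  if h : segment ℝ p q ⊆ A then
    closeUp x (.mk (segmentPath ⟨p, h (left_mem_segment ℝ p q)⟩ ⟨q, h (right_mem_segment ℝ p q)⟩ h))
  else 1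

/-- Only the cone over `γ` has to lie in `A`; this allows `γ` to cross several simplices of the star
of a vertex. -/
theorem closeUp_mul_segmentClass {v p q : A} (γ : Path p q)
    (h : ∀ t, segment ℝ (v : E) (γ t) ⊆ A) :
    closeUp x (.mk γ) * segmentClass x v p = segmentClass x (v : E) q := by
  have hp : segment ℝ (v : E) p ⊆ A := by simpa using h 0
  have hq : segment ℝ (v : E) q ⊆ A := by simpa using h 1
  rw [segmentClass, dif_pos hp, segmentClass, dif_pos hq, ← closeUp_trans,
    ← Path.Homotopic.Quotient.mk_trans]
  exact congrArg _ (Path.Homotopic.Quotient.eq.2 (segmentPath_trans_homotopic γ h hp hq))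

theorem segmentClass_self (p : E) : segmentClass x p p = 1 := by
  rw [segmentClass]
  split_ifs with h
  · rw [segmentPath_self, Path.Homotopic.Quotient.mk_refl, closeUp_refl]
  · rfl

theorem segmentClass_mul {S : Set E} (hS : Convex ℝ S) (hSA : S ⊆ A) {p q r : E} (hp : p ∈ S)
    (hq : q ∈ S) (hr : r ∈ S) :
    segmentClass x q r * segmentClass x p q = segmentClass x p r := by
  have h : segment ℝ q r ⊆ A := (hS.segment_subset hq hr).trans hSA
  rw [segmentClass, dif_pos h]
  refine closeUp_mul_segmentClass x (v := ⟨p, hSA hp⟩) _ fun t => ?_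
  refine (hS.segment_subset hp ?_).trans hSA
  exact lineMap_mem_of_segment_subset (hS.segment_subset hq hr) t

end SegmentClass

/-! ### Edge paths and connectedness in the realization -/

namespace PreAbstractSimplicialComplex

variable {V : Type*} [DecidableEq V] {Δ : PreAbstractSimplicialComplex V}

/-- The closed simplex spanned by the vertices in `F`. -/
def simplexHull (F : Finset V) : Set (V → ℝ) :=
  convexHull ℝ ((fun v : V => (Pi.single v 1 : V → ℝ)) '' (F : Set V))

theorem convex_simplexHull (F : Finset V) : Convex ℝ (simplexHull F) :=
  convex_convexHull _ _

theorem single_mem_simplexHull {F : Finset V} {v : V} (hv : v ∈ F) :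
    Pi.single v 1 ∈ simplexHull F :=
  subset_convexHull _ _ ⟨v, hv, rfl⟩

theorem simplexHull_subset_realization {F : Finset V} (hF : F ∈ Δ) :
    simplexHull F ⊆ Δ.realization :=
  Set.subset_biUnion_of_mem (u := fun F => simplexHull F) hF

theorem mem_realization {y : V → ℝ} : y ∈ Δ.realization ↔ ∃ F ∈ Δ, y ∈ simplexHull F := by
  simp [realization, simplexHull]

theorem eq_zero_of_mem_simplexHull {F : Finset V} {y : V → ℝ} (hy : y ∈ simplexHull F) {v : V}
    (hv : v ∉ F) : y v = 0 := by
  have : simplexHull F ⊆ {y : V → ℝ | y v = 0} := by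
    refine convexHull_min ?_ ?_
    · rintro _ ⟨w, hw, rfl⟩
      have : v ≠ w := by rintro rfl; exact hv hw
      simp [this]
    · intro a ha b hb s t _ _ _
      simp_all
  exact this hy

theorem sum_eq_one_of_mem_simplexHull [Fintype V] {F : Finset V} {y : V → ℝ}
    (hy : y ∈ simplexHull F) : ∑ v, y v = 1 := by
  have : simplexHull F ⊆ {y : V → ℝ | ∑ v, y v = 1} := by
    refine convexHull_min ?_ ?_
    · rintro _ ⟨w, hw, rfl⟩
      simp
    · intro a ha b hb s t _ _ h
      simp only [Set.mem_ofPred_eq] at ha hb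
      simp [Finset.sum_add_distrib, ← Finset.mul_sum, ha, hb, h]
  exact this hy

theorem exists_pos_of_mem_realization [Finite V] {y : V → ℝ} (hy : y ∈ Δ.realization) :
    ∃ v, 0 < y v := by
  have := Fintype.ofFinite V
  obtain ⟨F, _, hF⟩ := mem_realization.1 hy
  by_contra! h
  have h1 := sum_eq_one_of_mem_simplexHull hF
  have h2 : ∑ v, y v ≤ 0 := Finset.sum_nonpos fun v _ => h v
  linarith

theorem exists_face_of_mem_realization {y : V → ℝ} (hy : y ∈ Δ.realization) :
    ∃ F ∈ Δ, y ∈ simplexHull F ∧ ∀ v, 0 < y v → v ∈ F := by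
  obtain ⟨F, hF, hyF⟩ := mem_realization.1 hy
  exact ⟨F, hF, hyF, fun v hv => by_contra fun h =>
    hv.ne' (eq_zero_of_mem_simplexHull hyF h)⟩

/-- A positive coordinate at `v` forces `v` into the face carrying `y`, so the open star of `v` is
star-shaped about `v`. -/
theorem segment_single_subset {y : V → ℝ} (hy : y ∈ Δ.realization) {v : V} (hv : 0 < y v) :
    segment ℝ (Pi.single v 1) y ⊆ Δ.realization := by
  obtain ⟨F, hF, hyF, h⟩ := exists_face_of_mem_realization hy
  exact ((convex_simplexHull F).segment_subset (single_mem_simplexHull (h v hv)) hyF).trans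
    (simplexHull_subset_realization hF)

theorem single_mem_realization_iff {v : V} : Pi.single v 1 ∈ Δ.realization ↔ {v} ∈ Δ := by
  constructor
  · intro h
    obtain ⟨F, hF, _, h⟩ := exists_face_of_mem_realization h
    exact mem_of_subset hF (by simpa using h v (by simp)) (by simp)
  · intro h
    exact simplexHull_subset_realization h (single_mem_simplexHull (by simp))

/-- The loop class at `x` of the edge from `u` to `w`. -/
noncomputable def edgeClass [PathConnectedSpace Δ.realization] (x : Δ.realization) (u w : V) :
    FundamentalGroup Δ.realization x :=
  segmentClass x (Pi.single u 1) (Pi.single w 1)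

theorem edgeClass_mul [PathConnectedSpace Δ.realization] (x : Δ.realization) (u v w : V)
    (h : {u, v, w} ∈ Δ) : edgeClass x v w * edgeClass x u v = edgeClass x u w :=
  segmentClass_mul x (convex_simplexHull _) (simplexHull_subset_realization h)
    (single_mem_simplexHull (by simp)) (single_mem_simplexHull (by simp))
    (single_mem_simplexHull (by simp))

/-- Every path between vertices is homotopic to an edge path. -/
theorem isWalkProd_closeUp [Finite V] [PathConnectedSpace Δ.realization] (x : Δ.realization)
    {p q : Δ.realization} {u w : V} (hp : (p : V → ℝ) = Pi.single u 1)
    (hq : (q : V → ℝ) = Pi.single w 1) (γ : Path p q) :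
    IsWalkProd (fun v v' => v ≠ v' ∧ {v, v'} ∈ Δ) (edgeClass x) u w (closeUp x (.mk γ)) := by
  -- Lebesgue subdivision for the cover by open stars: each piece of `γ` stays in the open star of
  -- one vertex `i n`.
  obtain ⟨t, ht0, htm, ⟨m, hm⟩, hts⟩ := exists_monotone_Icc_subset_open_cover_unitInterval
    (c := fun v : V => {s : I | 0 < (γ s : V → ℝ) v})
    (fun v => isOpen_lt continuous_const ((continuous_apply v).comp
      (continuous_subtype_val.comp γ.continuous)))
    (fun s _ => by simpa using exists_pos_of_mem_realization (γ s).2)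
  choose i hi using hts
  -- The invariant: `γ` up to time `t n`, followed by the segment to any vertex whose open star
  -- contains `γ (t n)`, is an edge walk.
  have key : ∀ n v, 0 < (γ (t n) : V → ℝ) v →
      IsWalkProd (fun v v' => v ≠ v' ∧ {v, v'} ∈ Δ) (edgeClass x) u v
        (segmentClass x (γ (t n) : V → ℝ) (Pi.single v 1) * closeUp x (.mk (γ.subpath 0 (t n)))) := by
    intro n
    induction n with
    | zero =>
      intro v hv
      rw [ht0, Path.subpath_self, Path.Homotopic.Quotient.mk_refl, closeUp_refl, mul_one]
      rw [ht0, γ.source, hp] at hv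
      obtain rfl : v = u := by
        by_contra h
        simp [h] at hv
      rw [γ.source, hp, segmentClass_self]
      exact .nil _
    | succ n ih =>
      intro v hv
      have hle : t n ≤ t (n + 1) := htm n.le_succ
      have hin : 0 < (γ (t n) : V → ℝ) (i n) := hi n ⟨le_rfl, hle⟩
      have hin' : 0 < (γ (t (n + 1)) : V → ℝ) (i n) := hi n ⟨hle, le_rfl⟩
      have hwalk := ih (i n) hin
      set k := segmentClass x (γ (t n) : V → ℝ) (Pi.single (i n) 1) *
        closeUp x (.mk (γ.subpath 0 (t n))) with hk
      have hvert : Pi.single (i n) 1 ∈ Δ.realization :=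
        segment_single_subset (γ (t n)).2 hin (left_mem_segment _ _ _)
      have h1 : closeUp x (.mk (γ.subpath (t n) (t (n + 1)))) *
          segmentClass x (Pi.single (i n) 1) (γ (t n) : V → ℝ) =
          segmentClass x (Pi.single (i n) 1) (γ (t (n + 1)) : V → ℝ) := by
        refine closeUp_mul_segmentClass x (v := ⟨_, hvert⟩) _ fun s => ?_
        refine segment_single_subset (Subtype.prop _) ?_
        have hs : γ.subpath (t n) (t (n + 1)) s ∈ γ '' Set.Icc (t n) (t (n + 1)) := by
          rw [← Path.range_subpath_of_le _ _ _ hle]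
          exact Set.mem_range_self s
        obtain ⟨r, hr, hrs⟩ := hs
        rw [← hrs]
        exact hi n hr
      have h2 : segmentClass x (Pi.single (i n) 1) (γ (t n) : V → ℝ) *
          segmentClass x (γ (t n) : V → ℝ) (Pi.single (i n) 1) = 1 := by
        obtain ⟨F, hF, hyF, h⟩ := exists_face_of_mem_realization (γ (t n)).2
        have hv := single_mem_simplexHull (h _ hin)
        rw [segmentClass_mul x (convex_simplexHull F) (simplexHull_subset_realization hF) hyF hv hyF,
          segmentClass_self]
      obtain ⟨F, hF, hyF, h⟩ := exists_face_of_mem_realization (γ (t (n + 1))).2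
      have h3 : segmentClass x (γ (t (n + 1)) : V → ℝ) (Pi.single v 1) *
          segmentClass x (Pi.single (i n) 1) (γ (t (n + 1)) : V → ℝ) = edgeClass x (i n) v :=
        segmentClass_mul x (convex_simplexHull F) (simplexHull_subset_realization hF)
          (single_mem_simplexHull (h _ hin')) hyF (single_mem_simplexHull (h _ hv))
      have h4 : closeUp x (.mk (γ.subpath 0 (t (n + 1)))) =
          closeUp x (.mk (γ.subpath (t n) (t (n + 1)))) *
            closeUp x (.mk (γ.subpath 0 (t n))) := by
        rw [← closeUp_trans, ← Path.Homotopic.Quotient.mk_trans]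
        exact congrArg _ (Path.Homotopic.Quotient.eq.2
          ⟨(Path.Homotopy.subpathTransSubpath γ 0 (t n) (t (n + 1))).symm⟩)
      have h5 : segmentClass x (γ (t (n + 1)) : V → ℝ) (Pi.single v 1) *
          closeUp x (.mk (γ.subpath 0 (t (n + 1)))) = edgeClass x (i n) v * k := by
        rw [h4, ← h3, ← h1, hk]
        simp only [mul_assoc]
        rw [← mul_assoc (segmentClass x (Pi.single (i n) 1) _), h2, one_mul]
      rw [h5]
      by_cases hiv : i n = v
      · subst hiv
        rw [edgeClass, segmentClass_self, one_mul]
        exact hwalk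
      · refine hwalk.snoc ⟨hiv, mem_of_subset hF ?_ (by simp)⟩
        intro a ha
        rcases Finset.mem_insert.1 ha with rfl | ha
        · exact h _ hin'
        · rw [Finset.mem_singleton.1 ha]; exact h _ hv
  have h1 : t m = 1 := hm m le_rfl
  have := key m w (by rw [h1, γ.target, hq]; simp)
  rwa [h1, congrArg Subtype.val γ.target, hq, segmentClass_self, one_mul, Path.subpath_zero_one,
    Path.Homotopic.Quotient.mk_cast, closeUp_cast] at this

/-- The graph of a complex with connected realization is connected. -/
theorem reflTransGen_of_isPreconnected [Finite V] (h : IsPreconnected Δ.realization) {u w : V}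
    (hu : {u} ∈ Δ) (hw : {w} ∈ Δ) :
    Relation.ReflTransGen (fun v v' => v ≠ v' ∧ {v, v'} ∈ Δ) u w := by
  classical
  have := Fintype.ofFinite V
  by_contra hcon
  let A : Finset V := Finset.univ.filter fun v =>
    Relation.ReflTransGen (fun v v' => v ≠ v' ∧ {v, v'} ∈ Δ) u v
  have hA : ∀ F ∈ Δ, ∀ a ∈ F, a ∈ A → F ⊆ A := by
    intro F hF a ha haA b hb
    by_cases hab : a = b
    · exact hab ▸ haA
    · simp only [A, Finset.mem_filter, Finset.mem_univ, true_and] at haA ⊢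
      exact haA.tail ⟨hab, mem_of_subset hF (by simp [Finset.insert_subset_iff, ha, hb]) (by simp)⟩
  -- The total barycentric weight on the graph component of `u`. Every face lies inside or outside
  -- this component, so `f` cannot take the value 1/2 on the realization.
  let f : (V → ℝ) → ℝ := fun y => ∑ v ∈ A, y v
  have hf : Continuous f := by fun_prop
  have hfu : f (Pi.single u 1) = 1 := by
    have : u ∈ A := by simp [A, Relation.ReflTransGen.refl]
    simp [f, this]
  have hfw : f (Pi.single w 1) = 0 := by
    have : w ∉ A := by simpa [A] using hcon
    simp [f, this]
  obtain ⟨y, hy, hy2⟩ := h.intermediate_value (single_mem_realization_iff.2 hw)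
    (single_mem_realization_iff.2 hu) hf.continuousOn
    (show (1 / 2 : ℝ) ∈ Set.Icc _ _ by rw [hfu, hfw]; norm_num)
  obtain ⟨F, hF, hyF⟩ := mem_realization.1 hy
  by_cases hFA : ∃ a ∈ F, a ∈ A
  · obtain ⟨a, ha, haA⟩ := hFA
    have h1 : f y = ∑ v, y v := Finset.sum_subset (Finset.subset_univ _) fun v _ hv =>
      eq_zero_of_mem_simplexHull hyF fun hvF => hv (hA F hF a ha haA hvF)
    rw [sum_eq_one_of_mem_simplexHull hyF] at h1
    norm_num [h1] at hy2
  · push Not at hFA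
    have h1 : f y = 0 := Finset.sum_eq_zero fun v hv =>
      eq_zero_of_mem_simplexHull hyF fun hvF => hFA v hvF hv
    norm_num [h1] at hy2

theorem pathConnectedSpace_realization [Finite V] (h : IsConnected Δ.realization) :
    PathConnectedSpace Δ.realization := by
  have hseg : ∀ p q : Δ.realization, segment ℝ (p : V → ℝ) q ⊆ Δ.realization → Joined p q :=
    fun p q h => ⟨segmentPath p q h⟩
  obtain ⟨y, hy⟩ := h.nonempty
  obtain ⟨u, hu⟩ := exists_pos_of_mem_realization hy
  have hu' : Pi.single u 1 ∈ Δ.realization :=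
    segment_single_subset hy hu (left_mem_segment _ _ _)
  have hvert : ∀ w, Relation.ReflTransGen (fun v v' => v ≠ v' ∧ {v, v'} ∈ Δ) u w →
      ∀ hw : Pi.single w 1 ∈ Δ.realization, Joined (⟨_, hu'⟩ : Δ.realization) ⟨_, hw⟩ := by
    intro w hw
    induction hw with
    | refl => exact fun _ => .refl _
    | @tail a b _ hab ih =>
      intro hb
      have ha : Pi.single a 1 ∈ Δ.realization :=
        single_mem_realization_iff.2 (mem_of_subset hab.2 (by simp) (by simp))
      refine (ih ha).trans (hseg _ _ ?_)
      exact ((convex_simplexHull _).segment_subset (single_mem_simplexHull (by simp))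
        (single_mem_simplexHull (by simp))).trans (simplexHull_subset_realization hab.2)
  have hj : ∀ z : Δ.realization, Joined (⟨_, hu'⟩ : Δ.realization) z := by
    intro z
    obtain ⟨w, hw⟩ := exists_pos_of_mem_realization z.2
    have hs := segment_single_subset z.2 hw
    have hw' : Pi.single w 1 ∈ Δ.realization := hs (left_mem_segment _ _ _)
    exact (hvert w (reflTransGen_of_isPreconnected h.isPreconnected
      (single_mem_realization_iff.1 hu') (single_mem_realization_iff.1 hw')) hw').trans
      (hseg ⟨_, hw'⟩ z hs)
  exact ⟨⟨⟨y, hy⟩⟩, fun a b => (hj a).symm.trans (hj b)⟩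

end PreAbstractSimplicialComplex

/-! ### Dimension and face counts of the rank selected subcomplex -/

namespace PreAbstractSimplicialComplex

variable {V : Type*}

theorem card_le_dimSucc [Finite V] {Δ : PreAbstractSimplicialComplex V} {F : Finset V}
    (hF : Δ.IsFace F) : F.card ≤ Δ.dimSucc := by
  have := Fintype.ofFinite V
  refine le_csSup ⟨Fintype.card V, ?_⟩ ⟨F, hF, rfl⟩
  rintro _ ⟨G, _, rfl⟩
  exact G.card_le_univ

theorem exists_card_eq_dimSucc [Finite V] (Δ : PreAbstractSimplicialComplex V) :
    ∃ F, Δ.IsFace F ∧ F.card = Δ.dimSucc := by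
  have := Fintype.ofFinite V
  refine Nat.sSup_mem (s := {k : ℕ | ∃ F : Finset V, Δ.IsFace F ∧ F.card = k})
    ⟨0, ∅, Or.inl rfl, rfl⟩ ⟨Fintype.card V, ?_⟩
  rintro _ ⟨G, _, rfl⟩
  exact G.card_le_univ

theorem fNumber_neg_one (Δ : PreAbstractSimplicialComplex V) : Δ.fNumber (-1) = 1 := by
  rw [fNumber, Set.ncard_eq_one]
  refine ⟨∅, Set.ext fun F => ?_⟩
  simp only [Set.mem_ofPred_eq, Set.mem_singleton_iff]
  constructor
  · rintro ⟨_, h⟩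
    exact Finset.card_eq_zero.1 (by omega)
  · rintro rfl
    exact ⟨Or.inl rfl, by simp⟩

theorem hNumber_two {Δ : PreAbstractSimplicialComplex V} (h : Δ.dimSucc = 2) :
    Δ.hNumber 2 = (Δ.fNumber 1 : ℤ) - Δ.fNumber 0 + 1 := by
  rw [hNumber, h]
  simp only [Finset.sum_range_succ, Finset.sum_range_zero]
  norm_num [fNumber_neg_one]
  ring

variable {Δ : PreAbstractSimplicialComplex V} {C : Type*} {κ : V → C}

theorem IsProperColoring.injOn (hκ : Δ.IsProperColoring κ) {F : Finset V} (hF : F ∈ Δ) :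
    Set.InjOn κ F := fun v hv w hw h => by_contra fun hvw => hκ F hF v hv w hw hvw h

/-- A face with as many vertices as there are colours uses each colour exactly once. -/
theorem exists_mem_rankSelected_card_eq [Fintype C] [DecidableEq C] (hκ : Δ.IsProperColoring κ)
    {F : Finset V} (hF : F ∈ Δ) (hcard : F.card = Fintype.card C) {S : Finset C}
    (hS : S.Nonempty) : ∃ G ∈ Δ.rankSelected κ S, G.card = S.card := by
  have himage : F.image κ = Finset.univ := by
    rw [← Finset.card_eq_iff_eq_univ, Finset.card_image_of_injOn (hκ.injOn hF), hcard]
  have hGS : (F.filter fun v => κ v ∈ S).image κ = S := by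
    ext c
    simp only [Finset.mem_image, Finset.mem_filter]
    constructor
    · rintro ⟨v, hv, rfl⟩
      exact hv.2
    · intro hc
      obtain ⟨v, hv, rfl⟩ := Finset.mem_image.1 (himage ▸ Finset.mem_univ c)
      exact ⟨v, ⟨hv, hc⟩, rfl⟩
  have hne : (F.filter fun v => κ v ∈ S).Nonempty := by
    rw [← Finset.image_nonempty (f := κ), hGS]
    exact hS
  refine ⟨F.filter fun v => κ v ∈ S, ⟨mem_of_subset hF (Finset.filter_subset _ _) hne, ?_⟩, ?_⟩
  · simp
  · conv_rhs => rw [← hGS]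
    refine (Finset.card_image_of_injOn ?_).symm
    exact (hκ.injOn hF).mono (Finset.coe_subset.2 (Finset.filter_subset _ _))

theorem dimSucc_rankSelected [Finite V] [Fintype C] [DecidableEq C] (hκ : Δ.IsProperColoring κ)
    {F : Finset V} (hF : F ∈ Δ) (hcard : F.card = Fintype.card C) {S : Finset C}
    (hS : S.Nonempty) : (Δ.rankSelected κ S).dimSucc = S.card := by
  refine le_antisymm ?_ ?_
  · obtain ⟨G, hG, hGc⟩ := exists_card_eq_dimSucc (Δ.rankSelected κ S)
    rw [← hGc]
    rcases hG with rfl | hG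
    · simp
    · rw [← Finset.card_image_of_injOn (hκ.injOn hG.1)]
      exact Finset.card_le_card (Finset.image_subset_iff.2 hG.2)
  · obtain ⟨G, hG, hGc⟩ := exists_mem_rankSelected_card_eq hκ hF hcard hS
    exact hGc ▸ card_le_dimSucc (Or.inr hG)

variable [DecidableEq V]

theorem linkAdj_univ_of_link [Fintype C] {F : Finset V} {u w : V} (h : u ≠ w)
    (huw : {u, w} ∈ Δ.link F) : Δ.LinkAdj κ Finset.univ F u w := by
  obtain ⟨-, hd, hmem⟩ := huw
  rw [Finset.disjoint_right] at hd
  refine ⟨h, ⟨hd (by simp), by simp⟩, ⟨hd (by simp), by simp⟩, ?_⟩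
  convert hmem using 1
  ext
  simp only [Finset.mem_insert, Finset.mem_union, Finset.mem_singleton]
  tauto

theorem singleton_mem_link {F : Finset V} {u : V} (hu : u ∉ F) (h : insert u F ∈ Δ) :
    {u} ∈ Δ.link F := by
  refine ⟨mem_of_subset h (by simp) (by simp), by simpa using hu, ?_⟩
  rwa [Finset.union_comm, ← Finset.insert_eq]

theorem linksConnected_univ [Finite V] [Fintype C]
    (h : ∀ F : Finset V, Δ.IsFace F → F.card + 2 ≤ Fintype.card C →
      IsPreconnected (Δ.link F).realization) : Δ.LinksConnected κ Finset.univ := by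
  intro F hF _ hcard u w hu _ huF hw _ hwF
  refine Relation.ReflTransGen.mono (fun v v' hv => linkAdj_univ_of_link hv.1 hv.2) _ _
    (reflTransGen_of_isPreconnected (h F hF hcard) (singleton_mem_link hu huF)
      (singleton_mem_link hw hwF))

theorem link_empty : Δ.link ∅ = Δ := by
  ext F
  change (F ∈ Δ ∧ Disjoint ∅ F ∧ ∅ ∪ F ∈ Δ) ↔ F ∈ Δ
  simp

/-- The graph of the rank selected subcomplex `Δ_S`. -/
def rankSelectedGraph (Δ : PreAbstractSimplicialComplex V) (κ : V → C) (S : Finset C) :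
    SimpleGraph V where
  Adj := Δ.LinkAdj κ S ∅
  symm.symm u w h := ⟨h.1.symm, h.2.2.1, h.2.1, by rw [Finset.insert_comm]; exact h.2.2.2⟩
  loopless.irrefl u h := h.1 rfl

theorem ncard_edgeSet_le [Finite V] (S : Finset C) :
    (Δ.rankSelectedGraph κ S).edgeSet.ncard ≤ (Δ.rankSelected κ S).fNumber 1 := by
  refine Set.ncard_le_ncard_of_injOn Sym2.toFinset ?_ ?_ (Set.toFinite _)
  · intro e he
    induction e with | _ u w =>
    rw [SimpleGraph.mem_edgeSet] at he
    have huw : (s(u, w)).toFinset = {u, w} := by ext; simp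
    rw [huw]
    refine ⟨Or.inr ⟨he.2.2.2, ?_⟩, ?_⟩
    · simpa using ⟨he.2.1.2, he.2.2.1.2⟩
    · rw [Finset.card_pair he.1]; norm_num
  · intro e _ e' _ h
    ext v
    rw [← Sym2.mem_toFinset, h, Sym2.mem_toFinset]

/-- For `|S| = 2`, link connectivity at the empty face says that the graph of `Δ_S` is connected on
its vertices. Other elements of `V` may be isolated, so the component of `v₀` is counted. -/
theorem fNumber_zero_le [Finite V] {S : Finset C} (hS : S.card = 2)
    (h : Δ.LinksConnected κ S) {v₀ : V} (hv₀ : {v₀} ∈ Δ.rankSelected κ S) :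
    (Δ.rankSelected κ S).fNumber 0 ≤ {v | (Δ.rankSelectedGraph κ S).Reachable v₀ v}.ncard := by
  have hsub : {F : Finset V | (Δ.rankSelected κ S).IsFace F ∧ (F.card : ℤ) - 1 = 0} ⊆
      (fun v => {v}) '' {v | (Δ.rankSelectedGraph κ S).Reachable v₀ v} := by
    rintro F ⟨hF, hcard⟩
    obtain ⟨v, rfl⟩ := Finset.card_eq_one.1 (show F.card = 1 by omega)
    have hv : {v} ∈ Δ.rankSelected κ S := hF.resolve_left (by simp)
    refine ⟨v, ?_, rfl⟩
    rw [Set.mem_ofPred_eq, SimpleGraph.reachable_iff_reflTransGen]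
    exact h ∅ (Or.inl rfl) (by simp) (by simp [hS]) v₀ v (by simp) (hv₀.2 v₀ (by simp))
      (by simpa using hv₀.1) (by simp) (hv.2 v (by simp)) (by simpa using hv.1)
  exact (Set.ncard_le_ncard hsub (Set.toFinite _)).trans (Set.ncard_image_le (Set.toFinite _))

theorem exists_closure_eq_top [Finite V] [Fintype C] [DecidableEq C]
    (hκ : Δ.IsProperColoring κ) (hconn : IsConnected Δ.realization)
    (hlink : Δ.LinksConnected κ Finset.univ) {S : Finset C} (hS : S.card = 2) {v₀ : V}
    (hv₀ : {v₀} ∈ Δ.rankSelected κ S) (x : Δ.realization) :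
    ∃ s : Finset (FundamentalGroup Δ.realization x),
      Subgroup.closure (s : Set (FundamentalGroup Δ.realization x)) = ⊤ ∧
      s.card + (Δ.rankSelected κ S).fNumber 0 ≤ (Δ.rankSelected κ S).fNumber 1 + 1 := by
  have := pathConnectedSpace_realization hconn
  have hv₀S : κ v₀ ∈ S := hv₀.2 v₀ (by simp)
  obtain ⟨hconnS, hwalk⟩ := isWalkProd_of_subset hκ hlink hS (edgeClass_mul x) S subset_rfl
  have hinv : ∀ u w, (Δ.rankSelectedGraph κ S).Adj u w →
      edgeClass x w u = (edgeClass x u w)⁻¹ := by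
    intro u w h
    rw [eq_inv_iff_mul_eq_one, edgeClass_mul x u w u
      (mem_of_subset h.2.2.2 (by intro a; simp; tauto) (by simp))]
    exact segmentClass_self x _
  have hgen : ∀ k, IsWalkProd (Δ.rankSelectedGraph κ S).Adj (edgeClass x) v₀ v₀ k := by
    intro k
    obtain ⟨γ, rfl⟩ := closeUp_surjective x ⟨_, single_mem_realization_iff.2 hv₀.1⟩ k
    refine hwalk _ _ _ hv₀S hv₀S ((isWalkProd_closeUp x rfl rfl γ).mono fun u w h => ?_)
    exact linkAdj_univ_of_link h.1 (by rw [link_empty]; exact h.2)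
  obtain ⟨s, hs, hcard⟩ :=
    (Δ.rankSelectedGraph κ S).exists_closure_eq_top_of_isWalkProd v₀ (edgeClass x) hinv hgen
  have h1 := fNumber_zero_le hS hconnS hv₀
  have h2 := ncard_edgeSet_le (Δ := Δ) (κ := κ) S
  exact ⟨s, hs, by omega⟩

end PreAbstractSimplicialComplex

theorem corollary4p7 {V : Type*} [Finite V] [DecidableEq V]
    (Δ : PreAbstractSimplicialComplex V) (d : ℕ) (hd : 2 ≤ d) (hdim : Δ.dim = (d : ℤ) - 1)
    (hpure : Δ.IsPure)
    (κ : V → Fin d) (hκ : Δ.IsProperColoring κ)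
    (hlink : ∀ F : Finset V, Δ.IsFace F → F.card < d - 1 → IsConnected (Δ.link F).realization)
    (S : Finset (Fin d)) (hS : S.card = 2) :
    (∀ x : Δ.realization, ∃ _ : Group.FG (FundamentalGroup Δ.realization x),
      (Group.rank (FundamentalGroup Δ.realization x) : ℤ) ≤ (Δ.rankSelected κ S).hNumber 2) ∧
    (Δ.rankSelected κ S).hNumber 2 =
      ((Δ.rankSelected κ S).fNumber 1 : ℤ) - ((Δ.rankSelected κ S).fNumber 0 : ℤ) + 1 := by
  obtain ⟨F, hF, hFcard⟩ := Δ.exists_card_eq_dimSucc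
  have hdS : Δ.dimSucc = d := by
    rw [PreAbstractSimplicialComplex.dim] at hdim
    omega
  rw [hdS] at hFcard
  have hF' : F ∈ Δ := hF.resolve_left (by rintro rfl; simp at hFcard; omega)
  have hSne : S.Nonempty := Finset.card_pos.1 (by omega)
  have hFC : F.card = Fintype.card (Fin d) := by simpa using hFcard
  have hh := PreAbstractSimplicialComplex.hNumber_two
    ((PreAbstractSimplicialComplex.dimSucc_rankSelected hκ hF' hFC hSne).trans hS)
  refine ⟨fun x => ?_, hh⟩
  obtain ⟨G, hG, hGcard⟩ :=
    PreAbstractSimplicialComplex.exists_mem_rankSelected_card_eq hκ hF' hFC hSne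
  obtain ⟨v₀, hv₀⟩ : G.Nonempty := Finset.card_pos.1 (by omega)
  -- The link of the empty face, admissible since `0 < d - 1`.
  have hconn : IsConnected Δ.realization := by
    have := hlink ∅ (Or.inl rfl) (by simp; omega)
    rwa [PreAbstractSimplicialComplex.link_empty] at this
  have hlinks : Δ.LinksConnected κ Finset.univ :=
    PreAbstractSimplicialComplex.linksConnected_univ fun F hF hcard =>
      (hlink F hF (by rw [Fintype.card_fin] at hcard; omega)).isPreconnected
  obtain ⟨s, hs, hcard⟩ := PreAbstractSimplicialComplex.exists_closure_eq_top hκ hconn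
    hlinks hS (PreAbstractSimplicialComplex.mem_of_subset hG (by simpa using hv₀) (by simp)) x
  have hfg : Group.FG (FundamentalGroup Δ.realization x) := Group.fg_iff'.2 ⟨s.card, s, rfl, hs⟩
  refine ⟨hfg, ?_⟩
  have := Group.rank_le hs
  rw [hh]
  omega
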